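/- Let $q,\lambda\in\mathbb C$. For $\nu\in\{0,\tfrac12\}$ define $c_0=1$, $c_1=A_0c_0$, $c_{n+1}=A_nc_n+B_nc_{n-1}$ $(n\ge 1)$, where $$A_n=\frac{4(n+\nu)^2-(\lambda+2q)}{2(n+1+\nu)(2(n+\nu)+1)},\qquad B_n=\frac{4q}{2(n+1+\nu)(2(n+\nu)+1)},$$ and let $y(x)=\sum_{n\ge 0}c_nx^{n+\nu}$. Write $MF(q,\lambda;x)$ for $y$ when $\nu=0$ and $MS(q,\lambda;x)$ for $y$ when $\nu=\tfrac12$ (the Mathieu functions of the first and second kind). All powers and roots of complex numbers are principal values, and $$I_\alpha(z)=\sum_{l\ge 0}\frac{(z/2)^{2l+\alpha}}{l!\,\Gamma(l+\alpha+1)}.$$ For $j\ge 1$ and a function $F$ holomorphic on $\mathbb C\setminus\{0\}$ put, for $w\neq 0$, $$(D^{\nu}_jF)(w)=w^{-\frac12(j-1+\nu)}\Big(w\frac{d}{dw}\Big)^2\Big[w^{\frac12(j-1+\nu)}F(w)\Big]-\frac{\lambda+2q}{4^2}F(w)$$ (any local holomorphic branch of the power gives the same value), and $$(T^{\nu}_jF)(w)=\int_0^1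 dt\;t^{-\frac54+\frac12(j+\nu)}\int_0^1du\;u^{-1+\frac12(j+\nu)}\,I_0\big(2\sqrt{w(1-t)(1-u)}\big)\,(D^{\nu}_jF)(wtu).$$ Let $b_0(w)=w^{1/8}I_{-1/4}(2\sqrt w)$ and $b_{1/2}(w)=w^{-1/8}I_{1/4}(2\sqrt w)$ for $w\ne0$. Then the following hold. 1. For $|x|<1$ both Frobenius series converge absolutely. $MF$ is a holomorphic solution on $\{|x|<1\}$, and $MS$ one on $\{|x|<1\}\setminus(-1,0]$, of the Mathieu equation in algebraic form $$4x(1-x)y''+2(1-2x)y'+(\lambda+2q-4qx)y=0 .$$ 2. For all $w\neq 0$, with $(a)_i$ the rising factorial, $$\sum_{i\ge 0}\frac{w^i}{(1)_i(\frac34)_i}=\Gamma(\tfrac34)\,b_0(w),\qquad \sum_{i\ge 0}\frac{w^i}{(\frac54)_i(1)_i}=\Gamma(\tfrac54)\,b_{1/2}(w).$$ 3. For $\nu\in\{0,\tfrac12\}$ and every $n\ge 0$, the function $T^\nu_n\cdots T^\nu_1b_\nu$ is holomorphic on $\mathbb C\setminus\{0\}$ (for $n=0$ it is $b_\nu$),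 and the iterated integrals that define $T^\nu_{n+1}T^\nu_n\cdots T^\nu_1b_\nu$ converge absolutely at every $w\ne0$ (the inner one for every $0<t<1$). 4. If $q\neq 0$, $0<|x|<1$ and $\eta=\frac14qx^2$, then $$MF(q,\lambda;x)=\Gamma(\tfrac34)\Big\{\eta^{1/8}I_{-1/4}(2\sqrt\eta)+\sum_{n=1}^\infty\big(T^{0}_nT^{0}_{n-1}\cdots T^{0}_1\,b_0\big)(\eta)\,x^n\Big\},$$ $$MS(q,\lambda;x)=\Gamma(\tfrac54)\,x^{1/2}\Big\{\eta^{-1/8}I_{1/4}(2\sqrt\eta)+\sum_{n=1}^\infty\big(T^{1/2}_nT^{1/2}_{n-1}\cdots T^{1/2}_1\,b_{1/2}\big)(\eta)\,x^n\Big\},$$ where both series over $n$ converge absolutely. Written out, in the $n$-th term the factor $T^\nu_j$ ($n\ge j\ge1$, the factor $j=n$ outermost) has integration variables $t_j,u_j$ and is evaluated at $w_{j+1,n}$, and the innermost function is $b_\nu(w_{1,n})$, where $w_{a,n}=\eta\prod_{l=a}^nt_lu_l$ and $w_{n+1,n}=\eta$. -/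

import Mathlib

open MeasureTheory Set

noncomputable section

/-- The modified Bessel function of the first kind
`I_α(z) = ∑ₗ (z/2)^(2l+α) / (l! Γ(l+α+1))` (principal branch). -/
def besselI (α z : ℂ) : ℂ :=
  ∑' l : ℕ, (z / 2) ^ (2 * (l : ℂ) + α) / ((l.factorial : ℂ) * Complex.Gamma ((l : ℂ) + α + 1))

/-- The coefficient `A_n` of the three-term recurrence at the indicial root `ν`. -/
def mathieuA (q lam : ℂ) (ν : ℝ) (n : ℕ) : ℂ :=
  (4 * ((n : ℂ) + ν) ^ 2 - (lam + 2 * q)) / (2 * ((n : ℂ) + 1 + ν) * (2 * ((n : ℂ) + ν) + 1))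

/-- The coefficient `B_n` of the three-term recurrence at the indicial root `ν`. -/
def mathieuB (q : ℂ) (ν : ℝ) (n : ℕ) : ℂ :=
  4 * q / (2 * ((n : ℂ) + 1 + ν) * (2 * ((n : ℂ) + ν) + 1))

/-- The Frobenius coefficients: `c_0 = 1`, `c_1 = A_0 c_0`, `c_{n+1} = A_n c_n + B_n c_{n-1}`. -/
def mathieuCoeff (q lam : ℂ) (ν : ℝ) : ℕ → ℂ
  | 0 => 1
  | 1 => mathieuA q lam ν 0
  | n + 2 => mathieuA q lam ν (n + 1) * mathieuCoeff q lam ν (n + 1)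
      + mathieuB q ν (n + 1) * mathieuCoeff q lam ν n

/-- The `n`-th term `c_n x^(n+ν)` of the Frobenius series about `x = 0`. -/
def mathieuTerm (q lam : ℂ) (ν : ℝ) (x : ℂ) (n : ℕ) : ℂ :=
  mathieuCoeff q lam ν n * x ^ ((n : ℂ) + ν)

/-- The Mathieu function of the first kind: the Frobenius series with `ν = 0`, `c_0 = 1`. -/
def mathieuMF (q lam x : ℂ) : ℂ := ∑' n : ℕ, mathieuTerm q lam 0 x n

/-- The Mathieu function of the second kind: the Frobenius series with `ν = 1/2`, `c_0 = 1`. -/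
def mathieuMS (q lam x : ℂ) : ℂ := ∑' n : ℕ, mathieuTerm q lam (1 / 2) x n

/-- `y` is a holomorphic solution on the open set `U` of the algebraic form
`4x(1-x) y'' + 2(1-2x) y' + (λ + 2q - 4qx) y = 0` of the Mathieu equation. -/
def SolvesMathieu (q lam : ℂ) (y : ℂ → ℂ) (U : Set ℂ) : Prop :=
  DifferentiableOn ℂ y U ∧ ∀ x ∈ U,
    4 * x * (1 - x) * deriv (deriv y) x + 2 * (1 - 2 * x) * deriv y x
      + (lam + 2 * q - 4 * q * x) * y x = 0

/-- The Euler operator `w ∂_w`. -/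
def eulerOp (f : ℂ → ℂ) (w : ℂ) : ℂ := w * deriv f w

/-- The differential operator `w^(-a) (w ∂_w)² w^a - (λ + 2q)/4²` with `a = (j - 1 + ν)/2`,
applied to `F` and evaluated at `w`. Near the point `w`, the power `v^a` is the holomorphic branch
`w^a (v/w)^a`, which takes the principal value at `v = w`; so the operator also makes sense on the
negative real axis, where the principal power is discontinuous. -/
def mathieuD (q lam : ℂ) (ν : ℝ) (j : ℕ) (F : ℂ → ℂ) (w : ℂ) : ℂ :=
  let a : ℂ := ((j : ℂ) - 1 + ν) / 2
  w ^ (-a) * eulerOp (eulerOp fun v => w ^ a * (v / w) ^ a * F v) w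
    - (lam + 2 * q) / 4 ^ 2 * F w

/-- The integrand of the inner (`u_j`) integral. -/
def innerIntegrand (q lam : ℂ) (ν : ℝ) (j : ℕ) (F : ℂ → ℂ) (w : ℂ) (t u : ℝ) : ℂ :=
  ((u ^ (-1 + ((j : ℝ) + ν) / 2) : ℝ) : ℂ)
    * besselI 0 (2 * (w * (1 - t) * (1 - u)) ^ (1 / 2 : ℂ))
    * mathieuD q lam ν j F (w * t * u)

/-- The integrand of the outer (`t_j`) integral. -/
def outerIntegrand (q lam : ℂ) (ν : ℝ) (j : ℕ) (F : ℂ → ℂ) (w : ℂ) (t : ℝ) : ℂ :=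
  ((t ^ (-(5 / 4) + ((j : ℝ) + ν) / 2) : ℝ) : ℂ)
    * ∫ u in (0 : ℝ)..1, innerIntegrand q lam ν j F w t u

/-- One factor of the ordered product of integral operators, acting on a function `F`:
`∫₀¹ dt t^(-5/4+(j+ν)/2) ∫₀¹ du u^(-1+(j+ν)/2) I_0(2 √(w(1-t)(1-u))) (D_j F)(w t u)`. -/
def mathieuStage (q lam : ℂ) (ν : ℝ) (j : ℕ) (F : ℂ → ℂ) (w : ℂ) : ℂ :=
  ∫ t in (0 : ℝ)..1, outerIntegrand q lam ν j F w t

/-- Both integrals in `mathieuStage` converge, for every `w ≠ 0`. -/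
def StageConverges (q lam : ℂ) (ν : ℝ) (j : ℕ) (F : ℂ → ℂ) : Prop :=
  ∀ w : ℂ, w ≠ 0 →
    (∀ t ∈ Ioo (0 : ℝ) 1, IntervalIntegrable (innerIntegrand q lam ν j F w t) volume 0 1) ∧
    IntervalIntegrable (outerIntegrand q lam ν j F w) volume 0 1

/-- The `n`-fold nested integral: the factors `j = n, n - 1, …, 1`, the first one outermost,
applied to the base function. In the term number `n`, evaluated at `η`, the factor `j` is evaluated
at `w_{j+1,n}`, its inner argument is `w_{j,n} = w_{j+1,n} t_j u_j`, and the base function is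
evaluated at `w_{1,n}`. -/
def mathieuNested (q lam : ℂ) (ν : ℝ) (base : ℂ → ℂ) : ℕ → ℂ → ℂ
  | 0 => base
  | n + 1 => mathieuStage q lam ν (n + 1) (mathieuNested q lam ν base n)

/-- `w^(1/8) I_{-1/4}(2 √w)`. -/
def baseFirst (w : ℂ) : ℂ :=
  w ^ (1 / 8 : ℂ) * besselI (-(1 / 4)) (2 * w ^ (1 / 2 : ℂ))

/-- `w^(-1/8) I_{1/4}(2 √w)`. -/
def baseSecond (w : ℂ) : ℂ :=
  w ^ (-(1 / 8) : ℂ) * besselI (1 / 4) (2 * w ^ (1 / 2 : ℂ))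

/-- The rising factorial `(a)_i`. -/
def risingFactorial (a : ℂ) (i : ℕ) : ℂ := (ascPochhammer ℂ i).eval a

end

/-! The recurrence for `c_N` is sorted by how often an `A` is used. An `A` step raises the index by
one and a `B` step by two, so the part `d(N, n)` of degree `n` in the `A`'s vanishes unless `N = n +
2m`, and `c_N = ∑ₙ d(N, n)`. For fixed `n` the terms `d(n + 2m, n) x^(n+2m)` form `x^n` times a
power series in `η = q x² / 4`, since `B` carries the factor `q / 4`. The claim is that this series
is, up to the Gamma factor, the `n`-fold nested integral.

For `n = 0` it is the base Bessel function. One integral operator acts on an entire series as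
follows. The differential operator multiplies the `m`-th coefficient by `(m + a)² - (λ + 2q)/16`,
which is the numerator of `A_{n+2m}` divided by 16. Expanding `I_0` and integrating termwise gives
two Beta values, whose sum over the antidiagonal satisfies a first-order recurrence in `m`
(`sum_antidiagonal_eq_stageCoeff`). It is exactly the recurrence linking degree `n` to degree `n +
1` (`recurrencePart_eq_nestedCoeff`).

Regrouping the double series needs absolute convergence over all pairs `(N, n)`. The sums `∑ₙ ‖d(N,
n)‖` obey a majorant recurrence with coefficients `‖A_N‖ → 1` and `‖B_N‖ → 0`, so they grow slower
than `K^N` for each `K > 1`, which suffices when `‖x‖ < 1`. -/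

/-! ### Power series, and growth under a three-term recurrence. -/

theorem hasSum_deriv_powerSeries {f : ℕ → ℂ} {R : ℝ}
    (hf : ∀ z ∈ Metric.ball (0 : ℂ) R, Summable fun n => f n * z ^ n) {z : ℂ}
    (hz : z ∈ Metric.ball (0 : ℂ) R) :
    HasSum (fun n : ℕ => ((n : ℂ) + 1) * f (n + 1) * z ^ n)
      (deriv (fun w => ∑' n, f n * w ^ n) z) ∧
    DifferentiableAt ℂ (fun w => ∑' n, f n * w ^ n) z := by
  have hz' : ‖z‖ < R := by simpa using hz
  obtain ⟨r, hzr, hrR⟩ := exists_between hz'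
  have hr : 0 < r := (norm_nonneg z).trans_lt hzr
  have hu : Summable fun n => ‖f n * (r : ℂ) ^ n‖ :=
    (hf r (by simpa [abs_of_pos hr] using hrR)).norm
  have hd : ∀ n : ℕ, DifferentiableOn ℂ (fun w : ℂ => f n * w ^ n) (Metric.ball 0 r) :=
    fun n => by fun_prop
  have hle : ∀ (n : ℕ) (w : ℂ), w ∈ Metric.ball (0 : ℂ) r →
      ‖f n * w ^ n‖ ≤ ‖f n * (r : ℂ) ^ n‖ := by
    intro n w hw
    have hw' : ‖w‖ < r := by simpa using hw
    simp only [norm_mul, norm_pow, Complex.norm_real, Real.norm_eq_abs, abs_of_pos hr]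
    gcongr
  have hzb : z ∈ Metric.ball (0 : ℂ) r := by simpa using hzr
  refine ⟨?_, (Complex.differentiableOn_tsum_of_summable_norm hu hd Metric.isOpen_ball
    hle).differentiableAt (Metric.isOpen_ball.mem_nhds hzb)⟩
  have h := Complex.hasSum_deriv_of_summable_norm hu hd Metric.isOpen_ball hle hzb
  rw [← hasSum_nat_add_iff' 1] at h
  simp only [Finset.range_one, Finset.sum_singleton, pow_zero, deriv_const', sub_zero] at h
  refine h.congr_fun ?_
  intro n
  have : HasDerivAt (fun w : ℂ => f (n + 1) * w ^ (n + 1))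
      (f (n + 1) * (((n + 1 : ℕ) : ℂ) * z ^ n)) z := by
    simpa using (hasDerivAt_pow (n + 1) z).const_mul (f (n + 1))
  rw [this.deriv]; push_cast; ring

theorem exists_le_mul_pow_of_recurrence {a α β : ℕ → ℝ} (ha : ∀ n, 0 ≤ a n)
    (h : ∀ n, a (n + 2) ≤ α n * a (n + 1) + β n * a n)
    (hα : Filter.Tendsto α Filter.atTop (nhds 1)) (hβ : Filter.Tendsto β Filter.atTop (nhds 0))
    {K : ℝ} (hK : 1 < K) : ∃ C, ∀ n, a n ≤ C * K ^ n := by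
  have hK0 : 0 < K := by linarith
  -- The two tolerances are chosen so that `(1 + K)/2 * K + K(K - 1)/2 = K²`, which closes the
  -- induction exactly.
  have hε : 0 < K * (K - 1) / 2 := by nlinarith
  have e1 := hα.eventually_le_const (show (1 : ℝ) < (1 + K) / 2 by linarith)
  have e2 := hβ.eventually_le_const hε
  obtain ⟨N, hN⟩ := Filter.eventually_atTop.1 (e1.and e2)
  -- This constant dominates every ratio `a i / K ^ i` below the threshold, in particular the two
  -- initial values that the induction needs.
  refine ⟨∑ i ∈ Finset.range (N + 2), a i / K ^ i, ?_⟩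
  set C := ∑ i ∈ Finset.range (N + 2), a i / K ^ i
  have hC : 0 ≤ C := Finset.sum_nonneg fun i _ => by have := ha i; positivity
  intro n
  induction n using Nat.strong_induction_on with
  | _ n ih =>
    by_cases hn : n < N + 2
    · rw [← div_le_iff₀ (by positivity)]
      exact Finset.single_le_sum (f := fun i => a i / K ^ i)
        (fun i _ => by have := ha i; positivity) (Finset.mem_range.2 hn)
    · obtain ⟨m, rfl⟩ : ∃ m, n = m + 2 := ⟨n - 2, by omega⟩
      obtain ⟨h1, h2⟩ := hN m (by omega)
      calc a (m + 2) ≤ α m * a (m + 1) + β m * a m := h m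
        _ ≤ (1 + K) / 2 * (C * K ^ (m + 1)) + K * (K - 1) / 2 * (C * K ^ m) := by
            have i1 := ih (m + 1) (by omega)
            have i2 := ih m (by omega)
            have := ha m
            have := ha (m + 1)
            gcongr
        _ = C * K ^ (m + 2) := by ring

theorem summable_of_recurrence {a α β : ℕ → ℝ} (ha : ∀ n, 0 ≤ a n)
    (h : ∀ n, a (n + 2) ≤ α n * a (n + 1) + β n * a n)
    (hα : Filter.Tendsto α Filter.atTop (nhds 1)) (hβ : Filter.Tendsto β Filter.atTop (nhds 0))
    {r : ℝ} (hr0 : 0 ≤ r) (hr : r < 1) : Summable fun n => a n * r ^ n := by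
  obtain ⟨K, hK, hKr⟩ : ∃ K : ℝ, 1 < K ∧ K * r < 1 := by
    refine ⟨2 / (1 + r), by rw [lt_div_iff₀ (by linarith)]; linarith, ?_⟩
    rw [div_mul_eq_mul_div, div_lt_one (by linarith)]; linarith
  obtain ⟨C, hC⟩ := exists_le_mul_pow_of_recurrence ha h hα hβ hK
  refine Summable.of_nonneg_of_le (fun n => by have := ha n; positivity) (fun n => ?_)
    ((summable_geometric_of_lt_one (by positivity) hKr).mul_left C)
  rw [mul_pow, ← mul_assoc]
  gcongr
  exact hC n

/-- With `ε = 1/(n+1)` the coefficient is a rational function of `ε` that is continuous at `0`; the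
limit is its value there. -/
theorem tendsto_norm_mathieuB (q : ℂ) {ν : ℝ} (hν : 0 ≤ ν) :
    Filter.Tendsto (fun n => ‖mathieuB q ν (n + 1)‖) Filter.atTop (nhds 0) := by
  have hc : ContinuousAt (fun ε : ℂ => 4 * q * ε ^ 2 /
      (2 * (1 + (1 + ν) * ε) * (2 * (1 + ν * ε) + ε))) 0 :=
    ContinuousAt.div (by fun_prop) (by fun_prop) (by norm_num)
  have h := (hc.tendsto.comp (tendsto_one_div_add_atTop_nhds_zero_nat (𝕜 := ℂ))).norm
  simp only [Function.comp_def] at h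
  convert h using 2 with n
  · congr 1
    have h1 : (n : ℂ) + 1 ≠ 0 := by exact_mod_cast n.succ_ne_zero
    have h2 : (n : ℂ) + 1 + 1 + ν ≠ 0 := by exact_mod_cast (by positivity : (n : ℝ) + 1 + 1 + ν ≠ 0)
    have h3 : 2 * ((n : ℂ) + 1 + ν) + 1 ≠ 0 := by
      exact_mod_cast (by positivity : 2 * ((n : ℝ) + 1 + ν) + 1 ≠ 0)
    have e1 : 1 + (1 + (ν : ℂ)) * (1 / ((n : ℂ) + 1)) = (n + 1 + 1 + ν) / (n + 1) := by
      field_simp; ring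
    have e2 : 2 * (1 + (ν : ℂ) * (1 / ((n : ℂ) + 1))) + 1 / (n + 1)
        = (2 * ((n : ℂ) + 1 + ν) + 1) / (n + 1) := by
      field_simp
    rw [e1, e2, mathieuB]
    push_cast
    field_simp
  · simp

theorem tendsto_norm_mathieuA (q lam : ℂ) {ν : ℝ} (hν : 0 ≤ ν) :
    Filter.Tendsto (fun n => ‖mathieuA q lam ν (n + 1)‖) Filter.atTop (nhds 1) := by
  have hc : ContinuousAt (fun ε : ℂ => (4 * (1 + ν * ε) ^ 2 - (lam + 2 * q) * ε ^ 2) /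
      (2 * (1 + (1 + ν) * ε) * (2 * (1 + ν * ε) + ε))) 0 :=
    ContinuousAt.div (by fun_prop) (by fun_prop) (by norm_num)
  have h := (hc.tendsto.comp (tendsto_one_div_add_atTop_nhds_zero_nat (𝕜 := ℂ))).norm
  simp only [Function.comp_def] at h
  convert h using 2 with n
  · congr 1
    have h1 : (n : ℂ) + 1 ≠ 0 := by exact_mod_cast n.succ_ne_zero
    have h2 : (n : ℂ) + 1 + 1 + ν ≠ 0 := by exact_mod_cast (by positivity : (n : ℝ) + 1 + 1 + ν ≠ 0)
    have h3 : 2 * ((n : ℂ) + 1 + ν) + 1 ≠ 0 := by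
      exact_mod_cast (by positivity : 2 * ((n : ℝ) + 1 + ν) + 1 ≠ 0)
    have e1 : 1 + (1 + (ν : ℂ)) * (1 / ((n : ℂ) + 1)) = (n + 1 + 1 + ν) / (n + 1) := by
      field_simp; ring
    have e2 : 2 * (1 + (ν : ℂ) * (1 / ((n : ℂ) + 1))) + 1 / (n + 1)
        = (2 * ((n : ℂ) + 1 + ν) + 1) / (n + 1) := by
      field_simp
    rw [e1, e2, mathieuA]
    push_cast
    field_simp
  · norm_num

/-! ### The differential equation for the power series factor. -/

theorem hasSum_mul_shift {g g' : ℕ → ℂ} {S z : ℂ} (h : HasSum g S) (h0 : g' 0 = 0)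
    (hs : ∀ n, g' (n + 1) = z * g n) : HasSum g' (z * S) := by
  rw [← hasSum_nat_add_iff' 1]
  simpa [h0, hs] using h.mul_left z

/-- This is the Mathieu equation for `y = x^ν p` with `x^ν` divided out. The indicial equation `ν(2ν
- 1) = 0` kills the term in `p / x`. Comparing coefficients then leaves exactly the three-term
recurrence. -/
theorem mathieu_ode_powerSeries {q lam : ℂ} {ν : ℝ} (hν : 0 ≤ ν) (hν' : ν * (2 * ν - 1) = 0)
    (hs : ∀ z ∈ Metric.ball (0 : ℂ) 1, Summable fun n => mathieuCoeff q lam ν n * z ^ n)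
    {x : ℂ} (hx : x ∈ Metric.ball (0 : ℂ) 1) :
    let p := fun w => ∑' n, mathieuCoeff q lam ν n * w ^ n
    DifferentiableAt ℂ p x ∧ DifferentiableAt ℂ (deriv p) x ∧
    4 * x * (1 - x) * deriv (deriv p) x + (8 * ν * (1 - x) + 2 * (1 - 2 * x)) * deriv p x
      + (lam + 2 * q - 4 * ν ^ 2 - 4 * q * x) * p x = 0 := by
  intro p
  set c := mathieuCoeff q lam ν with hc
  obtain ⟨h1, d1⟩ := hasSum_deriv_powerSeries hs hx
  have hs1 : ∀ z ∈ Metric.ball (0 : ℂ) 1,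
      Summable fun n : ℕ => (((n : ℂ) + 1) * c (n + 1)) * z ^ n :=
    fun z hz => (hasSum_deriv_powerSeries hs hz).1.summable
  obtain ⟨h2, d2⟩ := hasSum_deriv_powerSeries (f := fun n : ℕ => ((n : ℂ) + 1) * c (n + 1)) hs1 hx
  have heq : deriv p =ᶠ[nhds x] fun w => ∑' n : ℕ, (((n : ℂ) + 1) * c (n + 1)) * w ^ n := by
    filter_upwards [Metric.isOpen_ball.mem_nhds hx] with z hz
    exact (hasSum_deriv_powerSeries hs hz).1.tsum_eq.symm
  refine ⟨d1, d2.congr_of_eventuallyEq heq, ?_⟩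
  rw [← heq.deriv_eq] at h2
  have h0 : HasSum (fun n => c n * x ^ n) (p x) := (hs x hx).hasSum
  have hxp2 : HasSum (fun n : ℕ => (n : ℂ) * ((n : ℂ) + 1) * c (n + 1) * x ^ n)
      (x * deriv (deriv p) x) :=
    hasSum_mul_shift h2 (by simp) fun n => by push_cast; ring
  have hxxp2 : HasSum (fun n : ℕ => (n : ℂ) * ((n : ℂ) - 1) * c n * x ^ n)
      (x * (x * deriv (deriv p) x)) :=
    hasSum_mul_shift hxp2 (by simp) fun n => by push_cast; ring
  have hxp1 : HasSum (fun n : ℕ => (n : ℂ) * c n * x ^ n) (x * deriv p x) :=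
    hasSum_mul_shift h1 (by simp) fun n => by push_cast; ring
  have hxp0 : HasSum (fun n : ℕ => if n = 0 then 0 else c (n - 1) * x ^ n) (x * p x) :=
    hasSum_mul_shift h0 (by simp) fun n => by simp; ring
  have key := ((((hxp2.mul_left 4).sub (hxxp2.mul_left 4)).add
    ((h1.mul_left (8 * (ν : ℂ) + 2)).sub (hxp1.mul_left (8 * (ν : ℂ) + 4)))).add
    (h0.mul_left (lam + 2 * q - 4 * (ν : ℂ) ^ 2))).sub (hxp0.mul_left (4 * q))
  have hz := key.unique (a₂ := 0) (by
    refine hasSum_zero.congr_fun fun n => ?_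
    have hνc : (ν : ℂ) * (2 * ν - 1) = 0 := by exact_mod_cast hν'
    rcases n with _ | n
    · have hd : (1 + (ν : ℂ)) ≠ 0 := by exact_mod_cast (by positivity : 1 + ν ≠ 0)
      have hd' : 2 * (ν : ℂ) + 1 ≠ 0 := by exact_mod_cast (by positivity : 2 * ν + 1 ≠ 0)
      have e : (2 * (1 + (ν : ℂ)) * (2 * ν + 1)) * c 1 = 4 * (ν : ℂ) ^ 2 - (lam + 2 * q) := by
        simp only [hc, mathieuCoeff, mathieuA]
        push_cast
        rw [zero_add, zero_add]
        field_simp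
      have e0 : c 0 = 1 := by simp [hc, mathieuCoeff]
      simp [e0]
      linear_combination e - 2 * c 1 * hνc
    · have hd : (n : ℂ) + 1 + 1 + ν ≠ 0 := by
        exact_mod_cast (by positivity : (n : ℝ) + 1 + 1 + ν ≠ 0)
      have hd' : 2 * ((n : ℂ) + 1 + ν) + 1 ≠ 0 := by
        exact_mod_cast (by positivity : 2 * ((n : ℝ) + 1 + ν) + 1 ≠ 0)
      have e : (2 * ((n : ℂ) + 1 + 1 + ν) * (2 * (n + 1 + ν) + 1)) * c (n + 2)
          = (4 * ((n : ℂ) + 1 + ν) ^ 2 - (lam + 2 * q)) * c (n + 1) + 4 * q * c n := by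
        simp only [hc, mathieuCoeff, mathieuA, mathieuB]
        push_cast
        field_simp
      simp only [Nat.add_sub_cancel, Nat.add_eq_zero_iff, one_ne_zero, and_false, if_false]
      push_cast
      linear_combination x ^ (n + 1) * (e - 2 * c (n + 2) * hνc))
  linear_combination hz

/-! ### Entire series and the differential operator. -/

/-- `F` is, away from the origin, the sum of the everywhere convergent power series with
coefficients `f`. -/
def HasEntireSeries (f : ℕ → ℂ) (F : ℂ → ℂ) : Prop :=
  ∀ w : ℂ, w ≠ 0 → HasSum (fun m => f m * w ^ m) (F w)

namespace HasEntireSeries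

variable {f : ℕ → ℂ} {F : ℂ → ℂ}

theorem summable (hF : HasEntireSeries f F) (z : ℂ) : Summable fun m => f m * z ^ m := by
  rcases eq_or_ne z 0 with rfl | hz
  · refine summable_of_ne_finset_zero (s := {0}) fun m hm => ?_
    simp [show m ≠ 0 by simpa using hm]
  · exact (hF z hz).summable

theorem eventuallyEq (hF : HasEntireSeries f F) {w : ℂ} (hw : w ≠ 0) :
    F =ᶠ[nhds w] fun z => ∑' m, f m * z ^ m := by
  filter_upwards [isOpen_ne.mem_nhds hw] with z hz using (hF z hz).tsum_eq.symm

theorem differentiableAt (hF : HasEntireSeries f F) {w : ℂ} (hw : w ≠ 0) :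
    DifferentiableAt ℂ F w :=
  (hasSum_deriv_powerSeries (R := ‖w‖ + 1) (fun z _ => hF.summable z)
    (by simp)).2.congr_of_eventuallyEq (hF.eventuallyEq hw)

theorem euler (hF : HasEntireSeries f F) : HasEntireSeries (fun m => m * f m) (eulerOp F) := by
  intro w hw
  have h := (hasSum_deriv_powerSeries (R := ‖w‖ + 1) (z := w) (fun z _ => hF.summable z)
    (by simp)).1
  rw [← (hF.eventuallyEq hw).deriv_eq] at h
  exact hasSum_mul_shift h (by simp) fun n => by push_cast; ring

theorem const_mul (hF : HasEntireSeries f F) (a : ℂ) :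
    HasEntireSeries (fun m => a * f m) (fun w => a * F w) := fun w hw => by
  simpa only [mul_assoc] using (hF w hw).mul_left a

theorem add {g : ℕ → ℂ} {G : ℂ → ℂ} (hF : HasEntireSeries f F) (hG : HasEntireSeries g G) :
    HasEntireSeries (fun m => f m + g m) (fun w => F w + G w) := fun w hw => by
  simpa only [add_mul] using (hF w hw).add (hG w hw)

end HasEntireSeries

/-- Conjugating `w ∂_w` by `w^a` adds `a`. The formula is needed on a neighbourhood of `w`, not only
at `w`, because the operator is applied twice; there `v / w` stays near `1`, away from the cut. -/
theorem eulerOp_branch_mul {F : ℂ → ℂ} {w a v : ℂ} (hv : v / w ∈ Complex.slitPlane)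
    (hF : DifferentiableAt ℂ F v) :
    eulerOp (fun z => w ^ a * (z / w) ^ a * F z) v
      = w ^ a * (v / w) ^ a * (a * F v + eulerOp F v) := by
  have hvw : v / w ≠ 0 := Complex.slitPlane_ne_zero hv
  have hv0 : v ≠ 0 := fun h => hvw (by simp [h])
  have hw0 : w ≠ 0 := fun h => hvw (by simp [h])
  have h1 : HasDerivAt (fun z : ℂ => (z / w) ^ a) (a * (v / w) ^ (a - 1) * (1 / w)) v :=
    ((hasDerivAt_id v).div_const w).cpow_const hv
  have h2 := (h1.const_mul (w ^ a)).mul hF.hasDerivAt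
  have h3 : (v / w) ^ a = (v / w) ^ (a - 1) * (v / w) := by
    rw [Complex.cpow_sub _ _ hvw, Complex.cpow_one, div_mul_cancel₀ _ hvw]
  unfold eulerOp
  have h4 : deriv (fun z => w ^ a * (z / w) ^ a * F z) v = _ := h2.deriv
  rw [h4, h3]
  field_simp

/-- The Euler operator is diagonal on monomials, with eigenvalue `m`, so the conjugated square has
eigenvalue `(m + a)²`. -/
theorem HasEntireSeries.mathieuD {f : ℕ → ℂ} {F : ℂ → ℂ} (hF : HasEntireSeries f F)
    (q lam : ℂ) (ν : ℝ) (j : ℕ) :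
    HasEntireSeries (fun m => (((m : ℂ) + ((j : ℂ) - 1 + ν) / 2) ^ 2 - (lam + 2 * q) / 4 ^ 2) * f m)
      (mathieuD q lam ν j F) := by
  intro w hw
  set a : ℂ := ((j : ℂ) - 1 + ν) / 2 with ha
  have h1 : HasEntireSeries _ (fun z => a * F z + eulerOp F z) := (hF.const_mul a).add hF.euler
  have h2 := (h1.const_mul a).add h1.euler
  have hmem : w / w ∈ Complex.slitPlane := by simp [div_self hw]
  have hnear : eulerOp (fun v => w ^ a * (v / w) ^ a * F v) =ᶠ[nhds w]
      fun v => w ^ a * (v / w) ^ a * (a * F v + eulerOp F v) := by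
    have : ContinuousAt (fun v => v / w) w := by fun_prop
    filter_upwards [this.preimage_mem_nhds (Complex.isOpen_slitPlane.mem_nhds hmem),
      isOpen_ne.mem_nhds hw] with v hv hv0
    exact eulerOp_branch_mul hv (hF.differentiableAt hv0)
  have hD : _root_.mathieuD q lam ν j F w
      = (a * (a * F w + eulerOp F w) + eulerOp (fun z => a * F z + eulerOp F z) w)
        - (lam + 2 * q) / 4 ^ 2 * F w := by
    have h3 : eulerOp (eulerOp fun v => w ^ a * (v / w) ^ a * F v) w
        = w ^ a * (a * (a * F w + eulerOp F w) + eulerOp (fun z => a * F z + eulerOp F z) w) := by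
      have h4 := eulerOp_branch_mul (a := a) hmem (h1.differentiableAt hw)
      rw [div_self hw, Complex.one_cpow, mul_one] at h4
      rw [← h4]
      show w * deriv _ w = w * deriv _ w
      rw [hnear.deriv_eq]
    simp only [_root_.mathieuD, ← ha]
    rw [h3, ← mul_assoc, ← Complex.cpow_add _ _ hw]
    simp
  rw [hD]
  refine ((h2 w hw).sub ((hF w hw).mul_left ((lam + 2 * q) / 4 ^ 2))).congr_fun fun m => ?_
  ring

/-! ### Expansion of the kernel and termwise integration. -/

/-- Only even powers of the root occur in `I_0`, so the choice of branch disappears. -/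
theorem hasSum_besselI_zero (z : ℂ) :
    HasSum (fun l : ℕ => z ^ l / (l.factorial : ℂ) ^ 2) (besselI 0 (2 * z ^ (1 / 2 : ℂ))) ∧
    Summable fun l : ℕ => ‖z ^ l / (l.factorial : ℂ) ^ 2‖ := by
  have hs : Summable fun l : ℕ => ‖z ^ l / (l.factorial : ℂ) ^ 2‖ := by
    refine Summable.of_nonneg_of_le (fun _ => norm_nonneg _) (fun l => ?_)
      (Real.summable_pow_div_factorial ‖z‖)
    rw [norm_div, norm_pow, norm_pow, Complex.norm_natCast]
    have : (1 : ℝ) ≤ l.factorial := by exact_mod_cast l.factorial_pos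
    gcongr
    nlinarith
  refine ⟨?_, hs⟩
  suffices h : besselI 0 (2 * z ^ (1 / 2 : ℂ)) = ∑' l : ℕ, z ^ l / (l.factorial : ℂ) ^ 2 by
    rw [h]; exact hs.of_norm.hasSum
  refine tsum_congr fun l => ?_
  have h2 : 2 * z ^ (1 / 2 : ℂ) / 2 = z ^ (1 / 2 : ℂ) := by ring
  have h3 : 2 * (l : ℂ) + 0 = ((2 * l : ℕ) : ℂ) := by push_cast; ring
  rw [h2, h3, Complex.cpow_natCast, pow_mul, add_zero, Complex.Gamma_nat_eq_factorial]
  have h4 : (z ^ (1 / 2 : ℂ)) ^ 2 = z := by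
    rw [← Complex.cpow_nat_mul]; norm_num
  rw [h4]; ring

/-- Dominated convergence against the integrable weight `t^(p-1)`. Everything is required on the
open interval only: the endpoints are null, and at `0` the expansions used later are not available.
-/
theorem hasSum_intervalIntegral_rpow_mul {ι : Type*} [Countable ι] {p : ℝ} (hp : 0 < p)
    {φ : ι → ℝ → ℂ} {b : ι → ℝ} (hφ : ∀ i, Continuous (φ i))
    (hb : ∀ i, ∀ t ∈ Ioo (0 : ℝ) 1, ‖φ i t‖ ≤ b i) (hs : Summable b) {H : ℝ → ℂ}
    (hH : ∀ t ∈ Ioo (0 : ℝ) 1, HasSum (fun i => φ i t) (H t)) :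
    IntervalIntegrable (fun t => ((t ^ (p - 1) : ℝ) : ℂ) * H t) volume 0 1 ∧
    HasSum (fun i => ∫ t in (0 : ℝ)..1, ((t ^ (p - 1) : ℝ) : ℂ) * φ i t)
      (∫ t in (0 : ℝ)..1, ((t ^ (p - 1) : ℝ) : ℂ) * H t) := by
  have hint : IntervalIntegrable (fun t : ℝ => t ^ (p - 1)) volume 0 1 :=
    intervalIntegral.intervalIntegrable_rpow' (by linarith)
  have hmeas : ∀ g : ℝ → ℂ, ContinuousOn g (Ioo 0 1) →
      AEStronglyMeasurable (fun t => ((t ^ (p - 1) : ℝ) : ℂ) * g t)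
        (volume.restrict (Ioc (0 : ℝ) 1)) := by
    intro g hg
    rw [← Measure.restrict_congr_set (Ioo_ae_eq_Ioc (a := (0 : ℝ)) (b := 1) (μ := volume))]
    refine ContinuousOn.aestronglyMeasurable (ContinuousOn.mul ?_ hg) measurableSet_Ioo
    refine Complex.continuous_ofReal.comp_continuousOn ?_
    exact continuousOn_id.rpow_const fun t ht => Or.inl ht.1.ne'
  have hcont : ContinuousOn H (Ioo 0 1) :=
    (continuousOn_tsum (fun i => (hφ i).continuousOn) hs hb).congr
      fun t ht => (hH t ht).tsum_eq.symm
  have hae : ∀ᵐ t : ℝ, t ∈ uIoc (0 : ℝ) 1 → t ∈ Ioo (0 : ℝ) 1 := by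
    filter_upwards [Measure.ae_ne volume (1 : ℝ)] with t ht h
    rw [uIoc_of_le zero_le_one] at h
    exact ⟨h.1, lt_of_le_of_ne h.2 ht⟩
  have hnorm : ∀ t ∈ Ioo (0 : ℝ) 1, ‖((t ^ (p - 1) : ℝ) : ℂ)‖ = t ^ (p - 1) := fun t ht => by
    rw [Complex.norm_real, Real.norm_of_nonneg (Real.rpow_nonneg ht.1.le _)]
  constructor
  · refine (hint.mul_const (∑' i, b i)).mono_fun' ?_ ?_
    · rw [uIoc_of_le zero_le_one]
      exact hmeas H hcont
    · refine (ae_restrict_iff' measurableSet_uIoc).2 ?_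
      filter_upwards [hae] with t ht h
      have ht := ht h
      rw [norm_mul, hnorm t ht]
      have := Real.rpow_nonneg ht.1.le (p - 1)
      gcongr
      rw [← (hH t ht).tsum_eq]
      exact tsum_of_norm_bounded hs.hasSum fun i => hb i t ht
  · refine intervalIntegral.hasSum_integral_of_dominated_convergence
      (fun i t => t ^ (p - 1) * b i) (fun i => ?_) (fun i => ?_) ?_ ?_ ?_
    · rw [uIoc_of_le zero_le_one]
      exact hmeas _ (hφ i).continuousOn
    · filter_upwards [hae] with t ht h
      have ht := ht h
      rw [norm_mul, hnorm t ht]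
      have := Real.rpow_nonneg ht.1.le (p - 1)
      gcongr
      exact hb i t ht
    · exact Filter.Eventually.of_forall fun t _ => hs.mul_left _
    · simpa only [tsum_mul_left] using hint.mul_const (∑' i, b i)
    · filter_upwards [hae] with t ht h
      exact (hH t (ht h)).mul_left _

theorem intervalIntegral_rpow_mul_pow_mul_one_sub_pow {p : ℝ} (hp : 0 < p) (m l : ℕ) :
    ∫ t in (0 : ℝ)..1, ((t ^ (p - 1) : ℝ) : ℂ) * ((t : ℂ) ^ m * (1 - (t : ℂ)) ^ l)
      = (l.factorial : ℂ) / ∏ k ∈ Finset.range (l + 1), ((p : ℂ) + m + k) := by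
  have h := Complex.betaIntegral_eval_nat_add_one_right (u := (p : ℂ) + m)
    (by simp; positivity) l
  rw [← h, Complex.betaIntegral]
  refine intervalIntegral.integral_congr_ae (Filter.Eventually.of_forall fun t ht => ?_)
  rw [uIoc_of_le zero_le_one] at ht
  have ht0 : (t : ℂ) ≠ 0 := by exact_mod_cast ht.1.ne'
  rw [Complex.ofReal_cpow ht.1.le, add_sub_cancel_right, Complex.cpow_natCast,
    show (p : ℂ) + m - 1 = ((p - 1 : ℝ) : ℂ) + m by push_cast; ring, Complex.cpow_add _ _ ht0,
    Complex.cpow_natCast, mul_assoc]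

/-- The factor `k = 0` is at least `p` and the factor `k ≥ 1` at least `k`. The bound is uniform in
`m` and `l`, so it can serve in the domination of the outer integral. -/
theorem norm_factorial_div_prod_le {p : ℝ} (hp : 0 < p) (m l : ℕ) :
    ‖(l.factorial : ℂ) / ∏ k ∈ Finset.range (l + 1), ((p : ℂ) + m + k)‖ ≤ 1 / p := by
  have hle : p * l.factorial ≤ ∏ k ∈ Finset.range (l + 1), (p + m + k) := by
    induction l with
    | zero => simp
    | succ l ih =>
      rw [Finset.prod_range_succ, Nat.factorial_succ]
      push_cast
      have h1 : (l : ℝ) + 1 ≤ p + m + (l + 1) := by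
        have : (0 : ℝ) ≤ m := by positivity
        linarith
      calc p * (((l : ℝ) + 1) * l.factorial) = p * l.factorial * (l + 1) := by ring
        _ ≤ _ := by gcongr
  have he : ∏ k ∈ Finset.range (l + 1), ((p : ℂ) + m + k)
      = ((∏ k ∈ Finset.range (l + 1), (p + m + k) : ℝ) : ℂ) := by push_cast; rfl
  have hpos : 0 < ∏ k ∈ Finset.range (l + 1), (p + m + k) :=
    lt_of_lt_of_le (by positivity) hle
  rw [he, norm_div, Complex.norm_natCast, Complex.norm_real, Real.norm_of_nonneg hpos.le,
    div_le_div_iff₀ hpos hp]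
  linarith

/-! ### The action of one integral operator on coefficients. -/

/-- The power series coefficients of `mathieuStage q lam ν j F` in terms of those of `F`. -/
noncomputable def stageCoeff (q lam : ℂ) (ν : ℝ) (j : ℕ) (f : ℕ → ℂ) : ℕ → ℂ
  | 0 => (((((j : ℂ) - 1 + ν) / 2) ^ 2 - (lam + 2 * q) / 4 ^ 2) * f 0)
      / (((j + ν) / 2 - 1 / 4) * ((j + ν) / 2))
  | M + 1 => ((((M : ℂ) + 1 + ((j : ℂ) - 1 + ν) / 2) ^ 2 - (lam + 2 * q) / 4 ^ 2) * f (M + 1)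
      + stageCoeff q lam ν j f M)
      / (((j + ν) / 2 - 1 / 4 + (M + 1)) * ((j + ν) / 2 + (M + 1)))

/-- From `M` to `M + 1` each old term acquires one new factor in either product. These factors
depend only on `i.1 + i.2 = M`, so they come out of the sum; the one new term is `(M + 1, 0)`. -/
theorem sum_antidiagonal_eq_stageCoeff (q lam : ℂ) (ν : ℝ) (j : ℕ) (f : ℕ → ℂ) (M : ℕ) :
    ∑ i ∈ Finset.HasAntidiagonal.antidiagonal M,
      (((i.1 : ℂ) + ((j : ℂ) - 1 + ν) / 2) ^ 2 - (lam + 2 * q) / 4 ^ 2) * f i.1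
        / ((∏ k ∈ Finset.range (i.2 + 1), (((j : ℂ) + ν) / 2 - 1 / 4 + i.1 + k))
          * ∏ k ∈ Finset.range (i.2 + 1), (((j : ℂ) + ν) / 2 + i.1 + k))
      = stageCoeff q lam ν j f M := by
  induction M with
  | zero => simp [stageCoeff]
  | succ M ih =>
    rw [Finset.Nat.sum_antidiagonal_succ', stageCoeff, ← ih, add_div (_ * f (M + 1)), Finset.sum_div]
    congr 1
    · simp
    · refine Finset.sum_congr rfl fun i hi => ?_
      have hM : (M : ℂ) = i.1 + i.2 := by
        rw [← Finset.HasAntidiagonal.mem_antidiagonal.1 hi]; push_cast; rfl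
      rw [Finset.prod_range_succ _ (i.2 + 1), Finset.prod_range_succ _ (i.2 + 1), div_div, hM]
      congr 1
      push_cast
      ring

/-- The coefficients of the expansion of the integrand of `mathieuStage` in powers of
`t`, `1 - t`, `u` and `1 - u`. -/
noncomputable def kernelCoeff (g : ℕ → ℂ) (w : ℂ) (i : ℕ × ℕ) : ℂ :=
  g i.1 * w ^ i.1 * (w ^ i.2 / (i.2.factorial : ℂ) ^ 2)

/-- The Beta value `∫₀¹ t^(p-1+m) (1-t)^l dt` for `(m, l) = i`. -/
noncomputable def betaCoeff (p : ℝ) (i : ℕ × ℕ) : ℂ :=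
  (i.2.factorial : ℂ) / ∏ k ∈ Finset.range (i.2 + 1), ((p : ℂ) + i.1 + k)

theorem integral_const_mul_eq_betaCoeff {p : ℝ} (hp : 0 < p) (c : ℂ) (i : ℕ × ℕ) :
    ∫ t in (0 : ℝ)..1, ((t ^ (p - 1) : ℝ) : ℂ) * (c * ((t : ℂ) ^ i.1 * (1 - (t : ℂ)) ^ i.2))
      = c * betaCoeff p i := by
  rw [betaCoeff, ← intervalIntegral_rpow_mul_pow_mul_one_sub_pow hp,
    ← intervalIntegral.integral_const_mul]
  refine intervalIntegral.integral_congr fun u _ => ?_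
  ring

theorem norm_pow_mul_one_sub_pow_le {t : ℝ} (ht : t ∈ Ioo (0 : ℝ) 1) (m l : ℕ) :
    ‖(t : ℂ) ^ m * (1 - (t : ℂ)) ^ l‖ ≤ 1 := by
  have h1 : ‖(t : ℂ)‖ ≤ 1 := by
    rw [Complex.norm_real, Real.norm_of_nonneg ht.1.le]; exact ht.2.le
  have h2 : ‖1 - (t : ℂ)‖ ≤ 1 := by
    rw [← Complex.ofReal_one, ← Complex.ofReal_sub, Complex.norm_real,
      Real.norm_of_nonneg (by linarith [ht.2])]
    linarith [ht.1]
  rw [norm_mul, norm_pow, norm_pow]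
  exact mul_le_one₀ (pow_le_one₀ (norm_nonneg _) h1) (by positivity)
    (pow_le_one₀ (norm_nonneg _) h2)

theorem hasSum_mul_of_summable_norm {f g : ℕ → ℂ} {a b : ℂ} (hf : HasSum f a) (hg : HasSum g b)
    (hf' : Summable fun n => ‖f n‖) (hg' : Summable fun n => ‖g n‖) :
    HasSum (fun i : ℕ × ℕ => f i.1 * g i.2) (a * b) :=
  hf.mul hg (summable_mul_of_summable_norm hf' hg')

section Kernel

variable {g : ℕ → ℂ} {G : ℂ → ℂ}

theorem HasEntireSeries.summable_norm_kernelCoeff (hG : HasEntireSeries g G) (w : ℂ) :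
    Summable fun i => ‖kernelCoeff g w i‖ := by
  simpa only [kernelCoeff] using Summable.mul_norm (f := fun m => g m * w ^ m)
    (g := fun l : ℕ => w ^ l / (l.factorial : ℂ) ^ 2) (hG.summable w).norm
    (hasSum_besselI_zero w).2

theorem HasEntireSeries.hasSum_kernel (hG : HasEntireSeries g G) {w : ℂ} (hw : w ≠ 0) {t u : ℝ}
    (ht : t ∈ Ioo (0 : ℝ) 1) (hu : u ∈ Ioo (0 : ℝ) 1) :
    HasSum (fun i : ℕ × ℕ => kernelCoeff g w i * ((t : ℂ) ^ i.1 * (1 - (t : ℂ)) ^ i.2) *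
        ((u : ℂ) ^ i.1 * (1 - (u : ℂ)) ^ i.2))
      (besselI 0 (2 * (w * (1 - t) * (1 - u)) ^ (1 / 2 : ℂ)) * G (w * t * u)) := by
  have hw' : w * t * u ≠ 0 :=
    mul_ne_zero (mul_ne_zero hw (by exact_mod_cast ht.1.ne')) (by exact_mod_cast hu.1.ne')
  obtain ⟨b1, b2⟩ := hasSum_besselI_zero (w * (1 - t) * (1 - u))
  have e : (fun i : ℕ × ℕ => kernelCoeff g w i * ((t : ℂ) ^ i.1 * (1 - (t : ℂ)) ^ i.2) *
        ((u : ℂ) ^ i.1 * (1 - (u : ℂ)) ^ i.2)) = fun i => g i.1 * (w * t * u) ^ i.1 *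
        ((w * (1 - t) * (1 - u)) ^ i.2 / (i.2.factorial : ℂ) ^ 2) := by
    funext i
    simp only [kernelCoeff, mul_pow]
    ring
  rw [e, mul_comm (besselI _ _)]
  exact hasSum_mul_of_summable_norm (f := fun m => g m * (w * t * u) ^ m)
    (g := fun l : ℕ => (w * (1 - t) * (1 - u)) ^ l / (l.factorial : ℂ) ^ 2)
    (hG _ hw') b1 (hG _ hw').summable.norm b2

theorem HasEntireSeries.hasSum_inner (hG : HasEntireSeries g G) {w : ℂ} (hw : w ≠ 0) {t : ℝ}
    (ht : t ∈ Ioo (0 : ℝ) 1) {s : ℝ} (hs : 0 < s) :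
    IntervalIntegrable (fun u : ℝ => ((u ^ (s - 1) : ℝ) : ℂ) *
      (besselI 0 (2 * (w * (1 - t) * (1 - u)) ^ (1 / 2 : ℂ)) * G (w * t * u))) volume 0 1 ∧
    HasSum (fun i => kernelCoeff g w i * betaCoeff s i * ((t : ℂ) ^ i.1 * (1 - (t : ℂ)) ^ i.2))
      (∫ u in (0 : ℝ)..1, ((u ^ (s - 1) : ℝ) : ℂ) *
        (besselI 0 (2 * (w * (1 - t) * (1 - u)) ^ (1 / 2 : ℂ)) * G (w * t * u))) := by
  have h := hasSum_intervalIntegral_rpow_mul hs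
    (φ := fun (i : ℕ × ℕ) (u : ℝ) => kernelCoeff g w i * ((t : ℂ) ^ i.1 * (1 - (t : ℂ)) ^ i.2) *
      ((u : ℂ) ^ i.1 * (1 - (u : ℂ)) ^ i.2)) (b := fun i => ‖kernelCoeff g w i‖)
    (fun i => by fun_prop) (fun i u hu => by
      rw [norm_mul, norm_mul, mul_assoc]
      exact mul_le_of_le_one_right (norm_nonneg _) (mul_le_one₀
        (norm_pow_mul_one_sub_pow_le ht i.1 i.2) (norm_nonneg _)
        (norm_pow_mul_one_sub_pow_le hu i.1 i.2))) (hG.summable_norm_kernelCoeff w)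
    (fun u hu => hG.hasSum_kernel hw ht hu)
  refine ⟨h.1, h.2.congr_fun fun i => ?_⟩
  rw [integral_const_mul_eq_betaCoeff hs, mul_right_comm]

theorem HasEntireSeries.hasSum_outer (hG : HasEntireSeries g G) {w : ℂ} {s p : ℝ} (hs : 0 < s)
    (hp : 0 < p) {H : ℝ → ℂ} (hH : ∀ t ∈ Ioo (0 : ℝ) 1, HasSum (fun i =>
      kernelCoeff g w i * betaCoeff s i * ((t : ℂ) ^ i.1 * (1 - (t : ℂ)) ^ i.2)) (H t)) :
    IntervalIntegrable (fun t : ℝ => ((t ^ (p - 1) : ℝ) : ℂ) * H t) volume 0 1 ∧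
    HasSum (fun i => kernelCoeff g w i * betaCoeff s i * betaCoeff p i)
      (∫ t in (0 : ℝ)..1, ((t ^ (p - 1) : ℝ) : ℂ) * H t) := by
  have h := hasSum_intervalIntegral_rpow_mul hp
    (φ := fun (i : ℕ × ℕ) (t : ℝ) =>
      kernelCoeff g w i * betaCoeff s i * ((t : ℂ) ^ i.1 * (1 - (t : ℂ)) ^ i.2))
    (b := fun i => ‖kernelCoeff g w i‖ * (1 / s)) (fun i => by fun_prop) (fun i t ht => by
      rw [norm_mul, norm_mul]
      refine (mul_le_of_le_one_right (by positivity)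
        (norm_pow_mul_one_sub_pow_le ht i.1 i.2)).trans ?_
      have : ‖betaCoeff s i‖ ≤ 1 / s := norm_factorial_div_prod_le hs i.1 i.2
      gcongr) ((hG.summable_norm_kernelCoeff w).mul_right _) hH
  refine ⟨h.1, h.2.congr_fun fun i => ?_⟩
  rw [integral_const_mul_eq_betaCoeff hp]

end Kernel

theorem hasSum_sum_antidiagonal {h : ℕ × ℕ → ℂ} {S : ℂ} (hS : HasSum h S) :
    HasSum (fun M => ∑ i ∈ Finset.HasAntidiagonal.antidiagonal M, h i) S := by
  have h2 := Finset.HasAntidiagonal.sigmaAntidiagonalEquivProd.hasSum_iff.2 hS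
  refine (h2.sigma fun M => hasSum_fintype _).congr_fun fun M => ?_
  exact (Finset.sum_coe_sort _ h).symm

theorem HasEntireSeries.mathieuStage {f : ℕ → ℂ} {F : ℂ → ℂ} (hF : HasEntireSeries f F)
    (q lam : ℂ) {ν : ℝ} (hν : 0 ≤ ν) {j : ℕ} (hj : 1 ≤ j) :
    StageConverges q lam ν j F ∧
      HasEntireSeries (stageCoeff q lam ν j f) (mathieuStage q lam ν j F) := by
  have hj' : (1 : ℝ) ≤ j := by exact_mod_cast hj
  have hs0 : 0 < ((j : ℝ) + ν) / 2 := by positivity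
  -- The weight `t^(-5/4 + (j+ν)/2)` is integrable at `0` because `j ≥ 1` makes this exponent
  -- parameter at least `1/4`.
  have hs1 : 0 < ((j : ℝ) + ν) / 2 - 1 / 4 := by linarith
  have hG := hF.mathieuD q lam ν j
  have hinner : ∀ w (t : ℝ), innerIntegrand q lam ν j F w t = fun u : ℝ =>
      ((u ^ (((j : ℝ) + ν) / 2 - 1) : ℝ) : ℂ) *
      (besselI 0 (2 * (w * (1 - t) * (1 - u)) ^ (1 / 2 : ℂ))
        * _root_.mathieuD q lam ν j F (w * t * u)) := by
    intro w t
    funext u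
    rw [innerIntegrand, mul_assoc, neg_add_eq_sub]
  have houter : ∀ w, outerIntegrand q lam ν j F w = fun t : ℝ =>
      ((t ^ (((j : ℝ) + ν) / 2 - 1 / 4 - 1) : ℝ) : ℂ) *
        ∫ u in (0 : ℝ)..1, innerIntegrand q lam ν j F w t u := by
    intro w
    funext t
    rw [outerIntegrand, show ((j : ℝ) + ν) / 2 - 1 / 4 - 1 = -(5 / 4) + ((j : ℝ) + ν) / 2 by ring]
  have inner : ∀ w : ℂ, w ≠ 0 → ∀ t ∈ Ioo (0 : ℝ) 1,
      IntervalIntegrable (innerIntegrand q lam ν j F w t) volume 0 1 ∧ _ := fun w hw t ht => by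
    simpa only [← hinner] using hG.hasSum_inner hw ht hs0
  have outer : ∀ w : ℂ, w ≠ 0 →
      IntervalIntegrable (outerIntegrand q lam ν j F w) volume 0 1 ∧ _ := fun w hw => by
    simpa only [← houter] using hG.hasSum_outer hs0 hs1 fun t ht => (inner w hw t ht).2
  refine ⟨fun w hw => ⟨fun t ht => (inner w hw t ht).1, (outer w hw).1⟩, fun w hw => ?_⟩
  refine (hasSum_sum_antidiagonal (outer w hw).2).congr_fun fun M => ?_
  rw [← sum_antidiagonal_eq_stageCoeff, Finset.sum_mul]
  refine Finset.sum_congr rfl fun i hi => ?_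
  have hfac : (i.2.factorial : ℂ) ≠ 0 := by exact_mod_cast i.2.factorial_ne_zero
  rw [← Finset.HasAntidiagonal.mem_antidiagonal.1 hi]
  -- The two Beta values bring `(l!)²`, which cancels the `(l!)²` of `I_0`.
  simp only [kernelCoeff, betaCoeff]
  push_cast
  rw [pow_add]
  field_simp

/-! ### The two Frobenius solutions. -/

theorem solvesMathieu_mathieuMF {q lam : ℂ}
    (hs : ∀ z ∈ Metric.ball (0 : ℂ) 1, Summable fun n => mathieuCoeff q lam 0 n * z ^ n) :
    SolvesMathieu q lam (fun x => ∑' n, mathieuCoeff q lam 0 n * x ^ n) (Metric.ball 0 1) := by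
  refine ⟨fun x hx => ?_, fun x hx => ?_⟩
  · exact (mathieu_ode_powerSeries le_rfl (by simp) hs hx).1.differentiableWithinAt
  · have h := (mathieu_ode_powerSeries le_rfl (by simp) hs hx).2.2
    push_cast at h
    linear_combination h

theorem hasDerivAt_sqrt_mul {P : ℂ → ℂ} {x : ℂ} (hx : x ∈ Complex.slitPlane)
    (hP : DifferentiableAt ℂ P x) :
    HasDerivAt (fun z : ℂ => z ^ (1 / 2 : ℂ) * P z)
      (x ^ (1 / 2 : ℂ) * (P x / (2 * x) + deriv P x)) x := by
  have hx0 := Complex.slitPlane_ne_zero hx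
  have h1 : HasDerivAt (fun z : ℂ => z ^ (1 / 2 : ℂ)) (1 / 2 * x ^ (1 / 2 - 1 : ℂ) * 1) x :=
    (hasDerivAt_id x).cpow_const hx
  refine (h1.mul hP.hasDerivAt).congr_deriv ?_
  rw [Complex.cpow_sub _ _ hx0, Complex.cpow_one]
  field_simp

theorem solvesMathieu_mathieuMS {q lam : ℂ}
    (hs : ∀ z ∈ Metric.ball (0 : ℂ) 1, Summable fun n => mathieuCoeff q lam (1 / 2) n * z ^ n) :
    SolvesMathieu q lam (fun x => x ^ (1 / 2 : ℂ) * ∑' n, mathieuCoeff q lam (1 / 2) n * x ^ n)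
      (Metric.ball 0 1 ∩ Complex.slitPlane) := by
  have hode := fun x hx => mathieu_ode_powerSeries (q := q) (lam := lam) (ν := 1 / 2) (x := x)
    (by norm_num) (by norm_num) hs hx
  set p : ℂ → ℂ := fun w => ∑' n, mathieuCoeff q lam (1 / 2) n * w ^ n with hp
  have hopen : IsOpen (Metric.ball (0 : ℂ) 1 ∩ Complex.slitPlane) :=
    Metric.isOpen_ball.inter Complex.isOpen_slitPlane
  refine ⟨fun x hx => (hasDerivAt_sqrt_mul hx.2
    (hode x hx.1).1).differentiableAt.differentiableWithinAt, fun x hx => ?_⟩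
  have hx0 := Complex.slitPlane_ne_zero hx.2
  obtain ⟨d1, d2, h⟩ := hode x hx.1
  have e1 : deriv (fun z => z ^ (1 / 2 : ℂ) * p z) =ᶠ[nhds x]
      fun z => z ^ (1 / 2 : ℂ) * (p z / (2 * z) + deriv p z) := by
    filter_upwards [hopen.mem_nhds hx] with z hz
    exact (hasDerivAt_sqrt_mul hz.2 (hode z hz.1).1).deriv
  have d3 : HasDerivAt (fun z => p z / (2 * z) + deriv p z)
      ((deriv p x * (2 * x) - p x * (2 * 1)) / (2 * x) ^ 2 + deriv (deriv p) x) x :=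
    (d1.hasDerivAt.div ((hasDerivAt_id x).const_mul 2) (by simpa using hx0)).add d2.hasDerivAt
  have e2 := (hasDerivAt_sqrt_mul hx.2 d3.differentiableAt).deriv
  change 4 * x * (1 - x) * deriv (deriv fun z => z ^ (1 / 2 : ℂ) * p z) x
    + 2 * (1 - 2 * x) * deriv (fun z => z ^ (1 / 2 : ℂ) * p z) x
    + (lam + 2 * q - 4 * q * x) * (x ^ (1 / 2 : ℂ) * p x) = 0
  rw [e1.deriv_eq, e2, e1.eq_of_nhds, d3.deriv]
  have h' : 4 * x * (1 - x) * deriv (deriv p) x + (8 * (1 / 2) * (1 - x) + 2 * (1 - 2 * x))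
      * deriv p x + (lam + 2 * q - 4 * (1 / 2) ^ 2 - 4 * q * x) * p x = 0 := by
    have := h
    push_cast at this
    exact this
  -- The equation with the common factor `x^(1/2)` removed; it reduces to the equation for `p` at `ν
  -- = 1/2`.
  have key : 4 * x * (1 - x) * ((p x / (2 * x) + deriv p x) / (2 * x)
      + ((deriv p x * (2 * x) - p x * (2 * 1)) / (2 * x) ^ 2 + deriv (deriv p) x))
      + 2 * (1 - 2 * x) * (p x / (2 * x) + deriv p x) + (lam + 2 * q - 4 * q * x) * p x = 0 := by
    rw [← h']
    field_simp
    ring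
  linear_combination x ^ (1 / 2 : ℂ) * key

/-! ### The base Bessel functions. -/

theorem risingFactorial_succ (a : ℂ) (i : ℕ) :
    risingFactorial a (i + 1) = risingFactorial a i * (a + i) := ascPochhammer_succ_eval i a

theorem risingFactorial_zero (a : ℂ) : risingFactorial a 0 = 1 := by simp [risingFactorial]

theorem risingFactorial_one (i : ℕ) : risingFactorial 1 i = i.factorial := by
  induction i with
  | zero => simp [risingFactorial_zero]
  | succ i ih => rw [risingFactorial_succ, ih, Nat.factorial_succ]; push_cast; ring

theorem norm_ofReal_add_natCast {c : ℝ} (hc : 0 ≤ c) (i : ℕ) : ‖(c : ℂ) + i‖ = c + i := by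
  rw [← Complex.ofReal_natCast, ← Complex.ofReal_add, Complex.norm_real,
    Real.norm_of_nonneg (by positivity)]

theorem three_quarters_le_norm_risingFactorial {c : ℝ} (hc : 3 / 4 ≤ c) (i : ℕ) :
    3 / 4 ≤ ‖risingFactorial c i‖ := by
  induction i with
  | zero => simp [risingFactorial_zero]; norm_num
  | succ i ih =>
    rw [risingFactorial_succ, norm_mul, norm_ofReal_add_natCast (by linarith)]
    rcases i with _ | i
    · simpa [risingFactorial_zero] using hc
    · have h : 1 ≤ c + (i + 1 : ℕ) := by
        push_cast
        have : (0 : ℝ) ≤ i := by positivity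
        linarith
      nlinarith

theorem Gamma_natCast_add {c : ℝ} (hc : 0 < c) (i : ℕ) :
    Complex.Gamma (i + c) = risingFactorial c i * Complex.Gamma c := by
  induction i with
  | zero => simp [risingFactorial_zero]
  | succ i ih =>
    have hne : (i : ℂ) + c ≠ 0 := by exact_mod_cast (by positivity : (i : ℝ) + c ≠ 0)
    rw [risingFactorial_succ, Nat.cast_succ, add_right_comm, Complex.Gamma_add_one _ hne, ih]
    ring

/-- Halving the imaginary part of the logarithm keeps it in the principal strip, so these principal
powers do compose. -/
theorem sqrt_cpow (w α : ℂ) : (w ^ (1 / 2 : ℂ)) ^ α = w ^ (α / 2) := by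
  rw [show α / 2 = (1 / 2 : ℂ) * α by ring, Complex.cpow_mul]
  all_goals
    have e : (Complex.log w * (1 / 2)).im = (Complex.log w).im / 2 := by
      rw [show (1 / 2 : ℂ) = ((1 / 2 : ℝ) : ℂ) by push_cast; rfl, Complex.im_mul_ofReal]; ring
    have h1 := Complex.neg_pi_lt_log_im w
    have h2 := Complex.log_im_le_pi w
    have := Real.pi_pos
    rw [e]; linarith

theorem hasSum_div_risingFactorial {c : ℝ} (hc : 3 / 4 ≤ c) {α β : ℂ} (hα : α + 1 = c)
    (hβ : β = -(α / 2)) {w : ℂ} (hw : w ≠ 0) :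
    HasSum (fun i : ℕ => w ^ i / (risingFactorial 1 i * risingFactorial c i))
      (Complex.Gamma c * (w ^ β * besselI α (2 * w ^ (1 / 2 : ℂ)))) := by
  have hs : Summable fun i : ℕ => w ^ i / (risingFactorial 1 i * risingFactorial c i) := by
    refine Summable.of_norm_bounded ((Real.summable_pow_div_factorial ‖w‖).mul_right (4 / 3))
      fun i => ?_
    have h := three_quarters_le_norm_risingFactorial hc i
    rw [risingFactorial_one, norm_div, norm_mul, norm_pow, Complex.norm_natCast, ← div_div,
      div_eq_mul_inv _ ‖risingFactorial _ _‖]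
    gcongr
    rw [show (4 / 3 : ℝ) = (3 / 4)⁻¹ by norm_num]
    gcongr
  suffices h : Complex.Gamma c * (w ^ β * besselI α (2 * w ^ (1 / 2 : ℂ)))
      = ∑' i : ℕ, w ^ i / (risingFactorial 1 i * risingFactorial c i) by
    rw [h]; exact hs.hasSum
  have hΓ : Complex.Gamma c ≠ 0 :=
    Complex.Gamma_ne_zero_of_re_pos (by simp only [Complex.ofReal_re]; linarith)
  rw [besselI, ← tsum_mul_left, ← tsum_mul_left]
  refine tsum_congr fun l => ?_
  have h2 : 2 * w ^ (1 / 2 : ℂ) / 2 = w ^ (1 / 2 : ℂ) := by ring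
  rw [h2, sqrt_cpow w, show (2 * (l : ℂ) + α) / 2 = l + α / 2 by ring, Complex.cpow_add _ _ hw,
    Complex.cpow_natCast, add_assoc, hα, Gamma_natCast_add (by linarith), risingFactorial_one, hβ,
    Complex.cpow_neg]
  have h3 : w ^ (α / 2) ≠ 0 := by simp [Complex.cpow_eq_zero_iff, hw]
  field_simp

/-! ### Splitting the recurrence by degree in `A`. -/

/-- The part of the solution of `c₀ = 1`, `c₁ = A₀ c₀`, `c_{N+1} = A_N c_N + B_N c_{N-1}` at `N`
that is homogeneous of degree `n` in the coefficients `A`. -/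
noncomputable def recurrencePart (A B : ℕ → ℂ) : ℕ → ℕ → ℂ
  | 0, 0 => 1
  | 0, _ + 1 => 0
  | 1, 0 => 0
  | 1, n + 1 => A 0 * recurrencePart A B 0 n
  | N + 2, 0 => B (N + 1) * recurrencePart A B N 0
  | N + 2, n + 1 => A (N + 1) * recurrencePart A B (N + 1) n
      + B (N + 1) * recurrencePart A B N (n + 1)

theorem recurrencePart_eq_zero (A B : ℕ → ℂ) :
    ∀ N n : ℕ, (∀ m, N ≠ n + 2 * m) → recurrencePart A B N n = 0
  | 0, 0, h => absurd rfl (h 0)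
  | 0, _ + 1, _ => by rw [recurrencePart]
  | 1, 0, _ => by rw [recurrencePart]
  | 1, n + 1, h => by
    rw [recurrencePart, recurrencePart_eq_zero A B 0 n fun m hm => h m (by omega), mul_zero]
  | N + 2, 0, h => by
    rw [recurrencePart, recurrencePart_eq_zero A B N 0 fun m hm => h (m + 1) (by omega), mul_zero]
  | N + 2, n + 1, h => by
    rw [recurrencePart, recurrencePart_eq_zero A B (N + 1) n fun m hm => h m (by omega),
      recurrencePart_eq_zero A B N (n + 1) fun m hm => h (m + 1) (by omega), mul_zero, mul_zero,
      add_zero]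

theorem recurrencePart_of_lt (A B : ℕ → ℂ) {N n : ℕ} (h : N < n) : recurrencePart A B N n = 0 :=
  recurrencePart_eq_zero A B N n fun m => by omega

theorem recurrencePart_succ_self (A B : ℕ → ℂ) (n : ℕ) :
    recurrencePart A B (n + 1) (n + 1) = A n * recurrencePart A B n n := by
  rcases n with _ | n
  · simp [recurrencePart]
  · rw [recurrencePart, recurrencePart_of_lt A B (show n < n + 1 + 1 by omega), mul_zero, add_zero]

theorem mathieuCoeff_eq_sum (q lam : ℂ) (ν : ℝ) : ∀ N, mathieuCoeff q lam ν N =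
    ∑ n ∈ Finset.range (N + 1), recurrencePart (mathieuA q lam ν) (mathieuB q ν) N n
  | 0 => by simp [mathieuCoeff, recurrencePart]
  | 1 => by simp [mathieuCoeff, recurrencePart, Finset.sum_range_succ]
  | N + 2 => by
    -- Two vanishing terms of degree above `N` are appended, so that this sum has the same range as
    -- the others after the degree-zero term is split off.
    have h := Finset.sum_range_succ' (recurrencePart (mathieuA q lam ν) (mathieuB q ν) N) (N + 2)
    rw [Finset.sum_range_succ, Finset.sum_range_succ, recurrencePart_of_lt _ _ (by omega),
      recurrencePart_of_lt _ _ (by omega), add_zero, add_zero] at h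
    rw [mathieuCoeff, mathieuCoeff_eq_sum q lam ν (N + 1), mathieuCoeff_eq_sum q lam ν N,
      Finset.sum_range_succ' _ (N + 2), h]
    simp only [recurrencePart, Finset.sum_add_distrib, ← Finset.mul_sum]
    ring

/-- Norms are taken degree by degree, since a bound on `c_N` alone would allow cancellation between
degrees and could not justify the exchange of sums. -/
theorem sum_norm_recurrencePart_le (A B : ℕ → ℂ) (N : ℕ) :
    ∑ n ∈ Finset.range (N + 3), ‖recurrencePart A B (N + 2) n‖ ≤
      ‖A (N + 1)‖ * ∑ n ∈ Finset.range (N + 2), ‖recurrencePart A B (N + 1) n‖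
      + ‖B (N + 1)‖ * ∑ n ∈ Finset.range (N + 1), ‖recurrencePart A B N n‖ := by
  have h := Finset.sum_range_succ' (fun n => ‖recurrencePart A B N n‖) (N + 2)
  rw [Finset.sum_range_succ, Finset.sum_range_succ, recurrencePart_of_lt _ _ (by omega),
    recurrencePart_of_lt _ _ (by omega), norm_zero, add_zero, add_zero] at h
  rw [h, Finset.sum_range_succ' _ (N + 2), mul_add, ← add_assoc, Finset.mul_sum, Finset.mul_sum,
    ← Finset.sum_add_distrib]
  refine add_le_add (Finset.sum_le_sum fun n _ => ?_) ?_
  · rw [recurrencePart, ← norm_mul, ← norm_mul]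
    exact norm_add_le _ _
  · rw [recurrencePart, norm_mul]

theorem summable_sum_norm_recurrencePart (q lam : ℂ) {ν : ℝ} (hν : 0 ≤ ν) {r : ℝ} (hr0 : 0 ≤ r)
    (hr : r < 1) : Summable fun N => (∑ n ∈ Finset.range (N + 1),
      ‖recurrencePart (mathieuA q lam ν) (mathieuB q ν) N n‖) * r ^ N :=
  summable_of_recurrence (fun _ => Finset.sum_nonneg fun _ _ => norm_nonneg _)
    (fun N => sum_norm_recurrencePart_le _ _ N) (tendsto_norm_mathieuA q lam hν)
    (tendsto_norm_mathieuB q hν) hr0 hr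

theorem summable_mathieuCoeff (q lam : ℂ) {ν : ℝ} (hν : 0 ≤ ν) {x : ℂ} (hx : ‖x‖ < 1) :
    Summable fun n => mathieuCoeff q lam ν n * x ^ n := by
  refine Summable.of_norm_bounded
    (summable_sum_norm_recurrencePart q lam hν (norm_nonneg x) hx) fun N => ?_
  rw [norm_mul, norm_pow, mathieuCoeff_eq_sum]
  gcongr
  exact norm_sum_le _ _

/-- Fubini for the absolutely summable family over pairs: summing over `n` first gives the Frobenius
series, summing over `N` first gives `g`. -/
theorem hasSum_tsum_recurrencePart (q lam : ℂ) {ν : ℝ} (hν : 0 ≤ ν) {x : ℂ} (hx : ‖x‖ < 1)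
    {g : ℕ → ℂ} (hg : ∀ n, HasSum (fun N =>
      recurrencePart (mathieuA q lam ν) (mathieuB q ν) N n * x ^ N) (g n)) :
    HasSum g (∑' N, mathieuCoeff q lam ν N * x ^ N) := by
  set d := recurrencePart (mathieuA q lam ν) (mathieuB q ν) with hd
  have hout : ∀ N n, n ∉ Finset.range (N + 1) → d N n = 0 := fun N n hn =>
    recurrencePart_of_lt _ _ (by simpa using hn)
  have hsn : Summable fun i : ℕ × ℕ => ‖d i.1 i.2 * x ^ i.1‖ := by
    refine (summable_prod_of_nonneg fun i => norm_nonneg _).2 ⟨fun N => ?_, ?_⟩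
    · exact summable_of_ne_finset_zero (s := Finset.range (N + 1))
        fun n hn => by simp [hout N n hn]
    · refine (summable_sum_norm_recurrencePart q lam hν (norm_nonneg x) hx).congr fun N => ?_
      rw [tsum_eq_sum (s := Finset.range (N + 1)) fun n hn => by simp [hout N n hn],
        Finset.sum_mul]
      simp [hd]
  have hsum := hsn.of_norm.hasSum
  have h1 : HasSum (fun N => mathieuCoeff q lam ν N * x ^ N) _ := hsum.prod_fiberwise fun N => by
    rw [mathieuCoeff_eq_sum, Finset.sum_mul]
    exact hasSum_sum_of_ne_finset_zero fun n hn => by simp [hout N n hn]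
  rw [h1.tsum_eq]
  exact ((Equiv.prodComm ℕ ℕ).hasSum_iff.2 hsum).prod_fiberwise hg

/-! ### Matching the degree parts with the nested integrals. -/

/-- The power series coefficients of `mathieuNested q lam ν base n` in terms of those of `base`. -/
noncomputable def nestedCoeff (q lam : ℂ) (ν : ℝ) (f : ℕ → ℂ) : ℕ → ℕ → ℂ
  | 0 => f
  | n + 1 => stageCoeff q lam ν (n + 1) (nestedCoeff q lam ν f n)

theorem HasEntireSeries.mathieuNested {f : ℕ → ℂ} {base : ℂ → ℂ} (hf : HasEntireSeries f base)
    (q lam : ℂ) {ν : ℝ} (hν : 0 ≤ ν) (n : ℕ) :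
    HasEntireSeries (nestedCoeff q lam ν f n) (mathieuNested q lam ν base n) := by
  induction n with
  | zero => exact hf
  | succ n ih => exact (ih.mathieuStage q lam hν (by omega)).2

theorem nested_holomorphic_and_converges {f : ℕ → ℂ} {base : ℂ → ℂ} (hf : HasEntireSeries f base)
    (q lam : ℂ) {ν : ℝ} (hν : 0 ≤ ν) (n : ℕ) :
    DifferentiableOn ℂ (mathieuNested q lam ν base n) {0}ᶜ ∧
      StageConverges q lam ν (n + 1) (mathieuNested q lam ν base n) :=
  ⟨fun _ hw => ((hf.mathieuNested q lam hν n).differentiableAt hw).differentiableWithinAt,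
    ((hf.mathieuNested q lam hν n).mathieuStage q lam hν (by omega)).1⟩

/-- Induction on the degree, and on `m` within each degree. With `j = n + 1` the denominators of `A`
and `B` at index `n + 2m` are 16 times those of the operator, so `A` has the matching numerator and
`B` supplies `q / 4`. The hypothesis on `f` is the degree-zero case, where only `B` acts. -/
theorem recurrencePart_eq_nestedCoeff (q lam : ℂ) {ν : ℝ} (hν : 0 ≤ ν) {f : ℕ → ℂ} {G : ℂ}
    (h0 : G * f 0 = 1)
    (hf : ∀ m : ℕ, f (m + 1) * (((m : ℂ) + 1 + ν / 2) * (m + 1 + ν / 2 - 1 / 4)) = f m) (n m : ℕ) :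
    recurrencePart (mathieuA q lam ν) (mathieuB q ν) (n + 2 * m) n
      = G * nestedCoeff q lam ν f n m * (q / 4) ^ m := by
  have hA : ∀ k : ℕ, (k : ℂ) + 1 + ν ≠ 0 := fun k => by
    exact_mod_cast (by positivity : (k : ℝ) + 1 + ν ≠ 0)
  have hB : ∀ k : ℕ, 2 * ((k : ℂ) + ν) + 1 ≠ 0 := fun k => by
    exact_mod_cast (by positivity : 2 * ((k : ℝ) + ν) + 1 ≠ 0)
  induction n generalizing m with
  | zero =>
    induction m with
    | zero => simp [recurrencePart, nestedCoeff, h0]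
    | succ m ih =>
      rw [zero_add] at ih
      rw [show 0 + 2 * (m + 1) = 2 * m + 2 by ring, recurrencePart, ih, mathieuB]
      simp only [nestedCoeff]
      rw [← hf m]
      have h1 := hA (2 * m + 1)
      have h2 := hB (2 * m + 1)
      push_cast at h1 h2 ⊢
      field_simp
      ring
  | succ n ihn =>
    induction m with
    | zero =>
      have h := ihn 0
      rw [mul_zero, add_zero] at h ⊢
      rw [recurrencePart_succ_self, h, nestedCoeff, stageCoeff, mathieuA]
      have h1 := hA n
      have h2 := hB n
      have h3 : ((((n + 1 : ℕ) : ℂ) + ν) / 2 - 1 / 4) * ((((n + 1 : ℕ) : ℂ) + ν) / 2)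
          = (2 * ((n : ℂ) + 1 + ν) * (2 * ((n : ℂ) + ν) + 1)) / 16 := by push_cast; ring
      rw [h3]
      push_cast
      field_simp
      ring
    | succ m ihm =>
      rw [show n + 1 + 2 * (m + 1) = (n + 2 * m + 1) + 2 by ring, recurrencePart,
        show n + 2 * m + 1 + 1 = n + 2 * (m + 1) by ring,
        show n + 2 * m + 1 = n + 1 + 2 * m by ring, ihn, ihm, nestedCoeff, stageCoeff, mathieuA,
        mathieuB]
      have h1 := hA (n + 2 * (m + 1))
      have h2 := hB (n + 2 * (m + 1))
      have h3 : ((((n + 1 : ℕ) : ℂ) + ν) / 2 - 1 / 4 + (m + 1))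
            * ((((n + 1 : ℕ) : ℂ) + ν) / 2 + (m + 1))
          = (2 * (((n + 2 * (m + 1) : ℕ) : ℂ) + 1 + ν) * (2 * (((n + 2 * (m + 1) : ℕ) : ℂ) + ν) + 1))
            / 16 := by push_cast; ring
      rw [h3]
      field_simp
      push_cast
      ring

theorem hasSum_nested_mul_pow {q lam : ℂ} {ν : ℝ} (hν : 0 ≤ ν) {f : ℕ → ℂ} {base : ℂ → ℂ}
    (hbase : HasEntireSeries f base) {G : ℂ} (h0 : G * f 0 = 1)
    (hf : ∀ m : ℕ, f (m + 1) * (((m : ℂ) + 1 + ν / 2) * (m + 1 + ν / 2 - 1 / 4)) = f m)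
    {x η : ℂ} (hq : q ≠ 0) (hx0 : x ≠ 0) (hx : ‖x‖ < 1) (hη : η = 1 / 4 * q * x ^ 2) :
    Summable (fun n : ℕ => mathieuNested q lam ν base (n + 1) η * x ^ (n + 1)) ∧
    ∑' N, mathieuCoeff q lam ν N * x ^ N =
      G * (base η + ∑' n : ℕ, mathieuNested q lam ν base (n + 1) η * x ^ (n + 1)) := by
  have hη0 : η ≠ 0 := by rw [hη]; simp [hq, hx0]
  have hG : G ≠ 0 := fun h => by simp [h] at h0
  have key : HasSum (fun n => G * (mathieuNested q lam ν base n η * x ^ n))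
      (∑' N, mathieuCoeff q lam ν N * x ^ N) := by
    refine hasSum_tsum_recurrencePart q lam hν hx fun n => ?_
    have hinj : Function.Injective fun m : ℕ => n + 2 * m := fun a b h => by
      simp only at h; omega
    -- Only the indices `N = n + 2m` contribute, and there `(q/4)^m x^(n+2m) = η^m x^n`.
    rw [← hinj.hasSum_iff fun N hN => by
      rw [recurrencePart_eq_zero _ _ _ _ fun m hm => hN ⟨m, hm.symm⟩, zero_mul]]
    have h := ((hbase.mathieuNested q lam hν n η hη0).mul_right (x ^ n)).mul_left G
    refine h.congr_fun fun m => ?_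
    simp only [Function.comp_apply]
    rw [recurrencePart_eq_nestedCoeff q lam hν h0 hf, hη]
    ring
  have hs : Summable fun n => mathieuNested q lam ν base n η * x ^ n :=
    (summable_mul_left_iff hG).1 key.summable
  refine ⟨(summable_nat_add_iff 1).2 hs, ?_⟩
  rw [← key.tsum_eq, tsum_mul_left, hs.tsum_eq_zero_add, mathieuNested, pow_zero, mul_one]

/-! ### Specialisation to `ν = 0` and `ν = 1/2`. -/

theorem mathieuTerm_zero (q lam x : ℂ) :
    mathieuTerm q lam 0 x = fun n => mathieuCoeff q lam 0 n * x ^ n := by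
  funext n
  simp [mathieuTerm]

theorem mathieuTerm_half (q lam x : ℂ) : mathieuTerm q lam (1 / 2) x =
    fun n => x ^ (1 / 2 : ℂ) * (mathieuCoeff q lam (1 / 2) n * x ^ n) := by
  funext n
  rw [mathieuTerm, show (((1 / 2 : ℝ)) : ℂ) = 1 / 2 by push_cast; rfl]
  rcases eq_or_ne x 0 with rfl | hx
  -- The power law fails at `x = 0`, but both sides vanish there because the exponents are nonzero.
  · have h : (n : ℂ) + 1 / 2 ≠ 0 := by
      have : (((n : ℝ) + 1 / 2 : ℝ) : ℂ) ≠ 0 := Complex.ofReal_ne_zero.2 (by positivity)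
      push_cast at this
      exact this
    rw [Complex.zero_cpow h, Complex.zero_cpow (by norm_num)]
    ring
  · rw [Complex.cpow_add _ _ hx, Complex.cpow_natCast]
    ring

theorem mathieuMF_eq (q lam : ℂ) :
    mathieuMF q lam = fun x => ∑' n, mathieuCoeff q lam 0 n * x ^ n := by
  funext x
  rw [mathieuMF, mathieuTerm_zero]

theorem mathieuMS_eq (q lam : ℂ) : mathieuMS q lam =
    fun x => x ^ (1 / 2 : ℂ) * ∑' n, mathieuCoeff q lam (1 / 2) n * x ^ n := by
  funext x
  rw [mathieuMS, mathieuTerm_half, tsum_mul_left]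

theorem hasSum_baseFirst {w : ℂ} (hw : w ≠ 0) :
    HasSum (fun i : ℕ => w ^ i / (risingFactorial 1 i * risingFactorial (3 / 4) i))
      (Complex.Gamma (3 / 4) * baseFirst w) := by
  have h := hasSum_div_risingFactorial (c := 3 / 4) le_rfl (α := -(1 / 4)) (β := 1 / 8)
    (by push_cast; norm_num) (by norm_num) hw
  rwa [show ((3 / 4 : ℝ) : ℂ) = 3 / 4 by push_cast; rfl] at h

theorem hasSum_baseSecond {w : ℂ} (hw : w ≠ 0) :
    HasSum (fun i : ℕ => w ^ i / (risingFactorial (5 / 4) i * risingFactorial 1 i))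
      (Complex.Gamma (5 / 4) * baseSecond w) := by
  have h := hasSum_div_risingFactorial (c := 5 / 4) (by norm_num) (α := 1 / 4) (β := -(1 / 8))
    (by push_cast; norm_num) (by norm_num) hw
  rw [show ((5 / 4 : ℝ) : ℂ) = 5 / 4 by push_cast; rfl] at h
  simpa only [mul_comm (risingFactorial (5 / 4) _), baseSecond] using h

theorem hasEntireSeries_of_hasSum_mul {f : ℕ → ℂ} {F : ℂ → ℂ} {G : ℂ} (hG : G ≠ 0)
    (h : ∀ w : ℂ, w ≠ 0 → HasSum (fun i : ℕ => w ^ i / f i) (G * F w)) :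
    HasEntireSeries (fun i => (G * f i)⁻¹) F := fun w hw => by
  have h1 := (h w hw).mul_left G⁻¹
  rw [inv_mul_cancel_left₀ hG] at h1
  refine h1.congr_fun fun i => ?_
  dsimp only
  rw [mul_inv]; ring

theorem inv_mul_risingFactorial_succ {a b : ℂ} {m : ℕ} (ha : a + m ≠ 0) (hb : b + m ≠ 0) (G : ℂ) :
    (G * (risingFactorial a (m + 1) * risingFactorial b (m + 1)))⁻¹ * ((a + m) * (b + m))
      = (G * (risingFactorial a m * risingFactorial b m))⁻¹ := by
  rw [risingFactorial_succ, risingFactorial_succ, show G * (risingFactorial a m * (a + m) *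
    (risingFactorial b m * (b + m))) = G * (risingFactorial a m * risingFactorial b m)
      * ((a + m) * (b + m)) by ring, mul_inv (G * _), inv_mul_cancel_right₀ (mul_ne_zero ha hb)]

theorem mainTheorem3 (q lam : ℂ) :
    -- the Mathieu function of the first kind (`ν = 0`)
    ((∀ x : ℂ, ‖x‖ < 1 → Summable (mathieuTerm q lam 0 x)) ∧
      SolvesMathieu q lam (mathieuMF q lam) (Metric.ball 0 1) ∧
      (∀ w : ℂ, w ≠ 0 →
        HasSum (fun i : ℕ => w ^ i / (risingFactorial 1 i * risingFactorial (3 / 4) i))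
          (Complex.Gamma (3 / 4) * baseFirst w)) ∧
      (∀ n : ℕ, DifferentiableOn ℂ (mathieuNested q lam 0 baseFirst n) {0}ᶜ ∧
        StageConverges q lam 0 (n + 1) (mathieuNested q lam 0 baseFirst n)) ∧
      (∀ x η : ℂ, q ≠ 0 → x ≠ 0 → ‖x‖ < 1 → η = 1 / 4 * q * x ^ 2 →
        Summable (fun n : ℕ => mathieuNested q lam 0 baseFirst (n + 1) η * x ^ (n + 1)) ∧
        mathieuMF q lam x = Complex.Gamma (3 / 4) *
          (η ^ (1 / 8 : ℂ) * besselI (-(1 / 4)) (2 * η ^ (1 / 2 : ℂ))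
            + ∑' n : ℕ, mathieuNested q lam 0 baseFirst (n + 1) η * x ^ (n + 1)))) ∧
    -- the Mathieu function of the second kind (`ν = 1/2`)
    ((∀ x : ℂ, ‖x‖ < 1 → Summable (mathieuTerm q lam (1 / 2) x)) ∧
      SolvesMathieu q lam (mathieuMS q lam) (Metric.ball 0 1 ∩ Complex.slitPlane) ∧
      (∀ w : ℂ, w ≠ 0 →
        HasSum (fun i : ℕ => w ^ i / (risingFactorial (5 / 4) i * risingFactorial 1 i))
          (Complex.Gamma (5 / 4) * baseSecond w)) ∧
      (∀ n : ℕ, DifferentiableOn ℂ (mathieuNested q lam (1 / 2) baseSecond n) {0}ᶜ ∧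
        StageConverges q lam (1 / 2) (n + 1) (mathieuNested q lam (1 / 2) baseSecond n)) ∧
      (∀ x η : ℂ, q ≠ 0 → x ≠ 0 → ‖x‖ < 1 → η = 1 / 4 * q * x ^ 2 →
        Summable (fun n : ℕ => mathieuNested q lam (1 / 2) baseSecond (n + 1) η * x ^ (n + 1)) ∧
        mathieuMS q lam x = Complex.Gamma (5 / 4) * x ^ (1 / 2 : ℂ) *
          (η ^ (-(1 / 8) : ℂ) * besselI (1 / 4) (2 * η ^ (1 / 2 : ℂ))
            + ∑' n : ℕ,
                mathieuNested q lam (1 / 2) baseSecond (n + 1) η * x ^ (n + 1)))) := by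
  have hΓ1 : Complex.Gamma (3 / 4) ≠ 0 := Complex.Gamma_ne_zero_of_re_pos (by norm_num)
  have hΓ2 : Complex.Gamma (5 / 4) ≠ 0 := Complex.Gamma_ne_zero_of_re_pos (by norm_num)
  have hs1 : ∀ z ∈ Metric.ball (0 : ℂ) 1, Summable fun n => mathieuCoeff q lam 0 n * z ^ n :=
    fun z hz => summable_mathieuCoeff q lam le_rfl (by simpa using hz)
  have hs2 : ∀ z ∈ Metric.ball (0 : ℂ) 1,
      Summable fun n => mathieuCoeff q lam (1 / 2) n * z ^ n :=
    fun z hz => summable_mathieuCoeff q lam (by norm_num) (by simpa using hz)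
  have hb1 := hasEntireSeries_of_hasSum_mul hΓ1 fun w hw => hasSum_baseFirst hw
  have hb2 := hasEntireSeries_of_hasSum_mul hΓ2 fun w hw => hasSum_baseSecond hw
  have hne : ∀ (c : ℝ) (m : ℕ), 0 < c → (c : ℂ) + m ≠ 0 := fun c m hc => by
    exact_mod_cast (by positivity : c + m ≠ 0)
  have hn1 : ∀ m : ℕ, (1 : ℂ) + m ≠ 0 := fun m => by simpa using hne 1 m one_pos
  refine ⟨⟨fun x hx => ?_, ?_, fun w hw => hasSum_baseFirst hw,
    nested_holomorphic_and_converges hb1 q lam le_rfl, fun x η hq hx0 hx hη => ?_⟩,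
    fun x hx => ?_, ?_, fun w hw => hasSum_baseSecond hw,
    nested_holomorphic_and_converges hb2 q lam (by norm_num), fun x η hq hx0 hx hη => ?_⟩
  · rw [mathieuTerm_zero]
    exact hs1 x (by simpa using hx)
  · rw [mathieuMF_eq]
    exact solvesMathieu_mathieuMF hs1
  · rw [mathieuMF_eq]
    refine hasSum_nested_mul_pow le_rfl hb1 ?_ (fun m => ?_) hq hx0 hx hη
    · simp [risingFactorial_zero, hΓ1]
    · have h := inv_mul_risingFactorial_succ (hn1 m)
        (show (3 / 4 : ℂ) + m ≠ 0 by simpa using hne (3 / 4) m (by norm_num)) (Complex.Gamma (3 / 4))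
      rw [← h]
      push_cast
      ring
  · rw [mathieuTerm_half]
    exact (hs2 x (by simpa using hx)).mul_left _
  · rw [mathieuMS_eq]
    exact solvesMathieu_mathieuMS hs2
  · rw [mathieuMS_eq]
    have h := hasSum_nested_mul_pow (q := q) (lam := lam) (ν := 1 / 2) (by norm_num) hb2
      (G := Complex.Gamma (5 / 4)) (by simp [risingFactorial_zero, hΓ2]) (fun m => by
        rw [← inv_mul_risingFactorial_succ
          (show (5 / 4 : ℂ) + m ≠ 0 by simpa using hne (5 / 4) m (by norm_num)) (hn1 m)
          (Complex.Gamma (5 / 4))]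
        push_cast
        ring) hq hx0 hx hη
    refine ⟨h.1, ?_⟩
    dsimp only
    rw [h.2, baseSecond]
    ring
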